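/- For $k\ge 0$ let $q$ be the quadratic form $q(a,b)=a\cdot b=\sum_i a_ib_i$ on $\mathbb F_2^{2k}=\mathbb F_2^k\times\mathbb F_2^k$ (nondegenerate, of maximal Witt index), and let $O^+(2k,2)$ be its orthogonal group. For $0\le w\le k$ let $X_w$ be the set of $w$-dimensional totally isotropic subspaces of $(\mathbb F_2^{2k},q)$, i.e. those on which $q$ vanishes identically. For $w=k$, the space of complex functions on $X_k$ decomposes under $O^+(2k,2)$ as $\bigoplus_{m=0}^k V_m$, where $V_m$ is the irreducible subspace whose zonal functions have the form $S\mapsto P_m(|S\cap S'|)$, $S'\in X_k$, with $P_m$ a polynomial of degree $m$. A nonempty $\Sigma\subseteq X_k$ is called a $t$-design if $\sum_{S\in\Sigma}f(S)=0$ for all $f\in V_m$ and all $m$ with $1\le m\le\min(t,k)$. **Theorem.** There exist constants $d_{w,k}(t)$ (for integers $0\le w\le k$ and $t\ge 0$), namely $$d_{w,k}(t)=\frac1{|X_w|^2}\sum_{S,S'\in X_w}|S\cap S'|^t,$$ such that: 1. For every nonempty $\Sigma\subseteq X_w$, $$\frac1{|\Sigma|^2}\sum_{S,S'\in\Sigma}|S\cap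 S'|^t\ \ge\ d_{w,k}(t).$$ 2. When $w=k$, for every nonempty $\Sigma\subseteq X_k$, equality holds if and only if $\Sigma$ is a $t$-design. -/

import Mathlib

/-- The underlying vector space `F_2^{2k}`, written as pairs `(a, b)` with `a, b ∈ F_2^k`. -/
abbrev BinSpace (k : ℕ) : Type := (Fin k → ZMod 2) × (Fin k → ZMod 2)

/-- The quadratic form `q(a, b) = a · b` on `F_2^{2k}`
(nondegenerate, of maximal Witt index `k`). -/
def binForm (k : ℕ) : QuadraticForm (ZMod 2) (BinSpace k) :=
  LinearMap.BilinMap.toQuadraticMap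
    (LinearMap.mk₂ (ZMod 2) (fun x y : BinSpace k => x.1 ⬝ᵥ y.2)
      (fun _ _ _ => by simp [add_dotProduct])
      (fun _ _ _ => by simp [smul_dotProduct])
      (fun _ _ _ => by simp [dotProduct_add])
      (fun _ _ _ => by simp [dotProduct_smul]))

theorem binForm_apply (k : ℕ) (x : BinSpace k) : binForm k x = ∑ i, x.1 i * x.2 i := rfl

/-- The set `X_w` of totally isotropic subspaces of dimension `w` of `(F_2^{2k}, q)`,
i.e. the `w`-dimensional subspaces on which `q` vanishes identically. -/
def TotIso (k w : ℕ) : Type :=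
  {S : Submodule (ZMod 2) (BinSpace k) //
    Module.finrank (ZMod 2) S = w ∧ ∀ x ∈ S, binForm k x = 0}

instance instFiniteTotIso (k w : ℕ) : Finite (TotIso k w) :=
  inferInstanceAs (Finite {S : Submodule (ZMod 2) (BinSpace k) //
    Module.finrank (ZMod 2) S = w ∧ ∀ x ∈ S, binForm k x = 0})

noncomputable instance instFintypeTotIso (k w : ℕ) : Fintype (TotIso k w) :=
  Fintype.ofFinite _

/-- The number `|S ∩ S'|` of vectors in the intersection. -/
noncomputable def interCard {k w : ℕ} (S S' : TotIso k w) : ℕ :=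
  Nat.card (S.1 ⊓ S'.1 : Submodule (ZMod 2) (BinSpace k))

/-- The average `(1/|Σ|²) ∑_{S, S' ∈ Σ} |S ∩ S'|^t`. -/
noncomputable def interMoment {k w : ℕ} (t : ℕ) (A : Finset (TotIso k w)) : ℝ :=
  1 / (A.card : ℝ) ^ 2 * ∑ S ∈ A, ∑ S' ∈ A, (interCard S S' : ℝ) ^ t

/-- The orthogonal group `O⁺(2k, 2)` of `q` acts on `X_w` by taking images. -/
def isoMove {k w : ℕ} (g : (binForm k).IsometryEquiv (binForm k)) (S : TotIso k w) :
    TotIso k w :=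
  ⟨S.1.map (g.toLinearEquiv : BinSpace k →ₗ[ZMod 2] BinSpace k), by
    refine ⟨(LinearEquiv.finrank_map_eq g.toLinearEquiv S.1).trans S.2.1, ?_⟩
    rintro _ ⟨x, hx, rfl⟩
    exact (g.map_app x).trans (S.2.2 x hx)⟩

/-- A subspace of `L(X_w)`, the complex functions on `X_w`, stable under `O⁺(2k, 2)`. -/
def IsStableSubspace {k w : ℕ} (V : Submodule ℂ (TotIso k w → ℂ)) : Prop :=
  ∀ g : (binForm k).IsometryEquiv (binForm k), ∀ f ∈ V,
    (fun S => f (isoMove g S)) ∈ V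

/-- An irreducible subspace of `L(X_w)` under `O⁺(2k, 2)`. -/
def IsIrreducibleSubspace {k w : ℕ} (V : Submodule ℂ (TotIso k w → ℂ)) : Prop :=
  IsStableSubspace V ∧ V ≠ ⊥ ∧
    ∀ W : Submodule ℂ (TotIso k w → ℂ), IsStableSubspace W → W ≤ V → W = ⊥ ∨ W = V

/-- For maximal totally isotropic subspaces: the zonal functions of `V` are given by a polynomial
of degree exactly `m` in `|S ∩ S'|`. As `|S ∩ S'|` takes the `k + 1` values
`1, 2, …, 2 ^ k`, such a polynomial is normalised to have degree at most `k`. -/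
def HasZonalDegree {k : ℕ} (V : Submodule ℂ (TotIso k k → ℂ)) (m : ℕ) : Prop :=
  m ≤ k ∧ ∃ P : Polynomial ℂ, P ≠ 0 ∧ P.natDegree = m ∧
    ∀ S' : TotIso k k, (fun S => P.eval (interCard S S' : ℂ)) ∈ V

/-- `t`-designs of maximal totally isotropic subspaces: the characteristic function of `A` is
orthogonal to the irreducible subspaces `V_m` of `L(X_k)` for `1 ≤ m ≤ t`, where `V_m` is the
one whose zonal function is a polynomial of degree `m` in `|S ∩ S'|`. -/
def IsIsotropicDesign {k : ℕ} (t : ℕ) (A : Finset (TotIso k k)) : Prop :=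
  ∀ m : ℕ, 1 ≤ m → m ≤ t → ∀ V : Submodule ℂ (TotIso k k → ℂ),
    IsIrreducibleSubspace V → HasZonalDegree V m → ∀ f ∈ V, ∑ S ∈ A, f S = 0

/-! Since |S ∩ S'|^t counts the t-tuples of vectors lying in both S and S', the moment of Σ is the
sum over tuples T of the squared frequency with which T lies in a member of Σ. By transitivity of O⁺
on X_w the row sums of |S ∩ S'|^t are constant, so the excess over the moment of X_w is a sum of
squared differences of frequencies (`interMoment_sub_interMoment_univ`). The inequality follows,
with equality exactly when Σ and X_w give every tuple indicator the same average.

For w = k it remains to compare the span `tupleSpan k t` of these indicators with the spaces V_m. A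
Witt-type argument shows that O⁺ is transitive on pairs with given |S ∩ S'|
(`exists_isoMove_pair_eq`), so functions fixed by the stabilizer of S₀ are polynomials of degree at
most k in |S ∩ S₀|. The levels `tupleSpan k t` grow strictly up to t = k: level k is everything, a
stall would be permanent, and below k the parity of dim(S ∩ S₀) is orthogonal to the level
(`sum_parity_mul_tupleInd`). Each of the k steps adds a zonal function, and only k + 1 dimensions
are available, so level t contains exactly the zonal polynomials of degree at most t
(`zonalPoly_eq`). Hence the successive difference `harmonicSpace k t` is irreducible of zonal degree
t + 1, and any irreducible subspace of zonal degree m lies in level m. This matches equality of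
averages with the design condition. -/

open Module Submodule

/-! ### The polar form and orthogonal complements -/

/-- The bilinear form polar to `binForm k`. -/
noncomputable abbrev binPolar (k : ℕ) : LinearMap.BilinForm (ZMod 2) (BinSpace k) :=
  (binForm k).polarBilin

theorem binForm_add (k : ℕ) (x y : BinSpace k) :
    binForm k (x + y) = binForm k x + binForm k y + binPolar k x y :=
  QuadraticMap.map_add _ _ _

theorem binPolar_apply (k : ℕ) (x y : BinSpace k) :
    binPolar k x y = x.1 ⬝ᵥ y.2 + y.1 ⬝ᵥ x.2 := by
  have h := binForm_add k x y
  simp only [binForm_apply, ← dotProduct.eq_1] at h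
  have h2 : (x + y).1 ⬝ᵥ (x + y).2 = x.1 ⬝ᵥ x.2 + y.1 ⬝ᵥ y.2 + binPolar k x y := h
  simp only [Prod.fst_add, Prod.snd_add, add_dotProduct, dotProduct_add] at h2
  linear_combination -h2

theorem binPolar_comm (k : ℕ) (x y : BinSpace k) : binPolar k x y = binPolar k y x :=
  QuadraticMap.polar_comm _ _ _

theorem binPolar_isRefl (k : ℕ) : (binPolar k).IsRefl := fun x y h => by
  rw [binPolar_comm]; exact h

theorem binPolar_self (k : ℕ) (x : BinSpace k) : binPolar k x x = 0 := by
  rw [binPolar_apply]; exact CharTwo.add_self_eq_zero _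

theorem binPolar_nondegenerate (k : ℕ) : (binPolar k).Nondegenerate := by
  have h : (binPolar k).SeparatingLeft := by
    intro x hx
    refine Prod.ext (funext fun i => ?_) (funext fun i => ?_)
    · have := hx (0, Pi.single i 1)
      rw [binPolar_apply] at this
      simpa using this
    · have := hx (Pi.single i 1, 0)
      rw [binPolar_apply] at this
      simpa using this
  exact ⟨h, fun y hy => h y fun x => by rw [binPolar_comm]; exact hy x⟩

theorem finrank_binSpace (k : ℕ) : finrank (ZMod 2) (BinSpace k) = 2 * k := by
  simp [BinSpace, two_mul]

/-- The orthogonal complement with respect to the polar form. -/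
noncomputable abbrev perp {k : ℕ} (U : Submodule (ZMod 2) (BinSpace k)) :
    Submodule (ZMod 2) (BinSpace k) :=
  (binPolar k).orthogonal U

theorem mem_perp {k : ℕ} {U : Submodule (ZMod 2) (BinSpace k)} {x : BinSpace k} :
    x ∈ perp U ↔ ∀ y ∈ U, binPolar k y x = 0 := Iff.rfl

theorem finrank_add_finrank_perp {k : ℕ} (U : Submodule (ZMod 2) (BinSpace k)) :
    finrank (ZMod 2) U + finrank (ZMod 2) (perp U) = 2 * k := by
  have h : finrank (ZMod 2) (perp U) = _ :=
    LinearMap.BilinForm.finrank_orthogonal (binPolar_nondegenerate k) U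
  have h2 := U.finrank_le
  rw [finrank_binSpace] at h h2
  omega

theorem perp_perp {k : ℕ} (U : Submodule (ZMod 2) (BinSpace k)) : perp (perp U) = U :=
  LinearMap.BilinForm.orthogonal_orthogonal (binPolar_nondegenerate k) (binPolar_isRefl k) U

theorem perp_sup {k : ℕ} (U W : Submodule (ZMod 2) (BinSpace k)) :
    perp (U ⊔ W) = perp U ⊓ perp W := by
  ext x
  simp only [mem_inf, mem_perp]
  constructor
  · intro h
    exact ⟨fun y hy => h y (le_sup_left (a := U) hy), fun y hy => h y (le_sup_right (a := U) hy)⟩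
  · rintro ⟨h1, h2⟩ y hy
    obtain ⟨a, ha, b, hb, rfl⟩ := mem_sup.1 hy
    rw [map_add, LinearMap.add_apply, h1 a ha, h2 b hb, add_zero]

theorem perp_inf {k : ℕ} (U W : Submodule (ZMod 2) (BinSpace k)) :
    perp (U ⊓ W) = perp U ⊔ perp W := by
  rw [← perp_perp (perp U ⊔ perp W), perp_sup, perp_perp, perp_perp]

/-! ### Totally isotropic subspaces and their complements -/

/-- `U` is totally isotropic: the quadratic form vanishes on it. -/
def IsTotIso {k : ℕ} (U : Submodule (ZMod 2) (BinSpace k)) : Prop :=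
  ∀ x ∈ U, binForm k x = 0

namespace IsTotIso

variable {k : ℕ} {U W : Submodule (ZMod 2) (BinSpace k)}

theorem polar_eq_zero (hU : IsTotIso U) {x y : BinSpace k} (hx : x ∈ U) (hy : y ∈ U) :
    binPolar k x y = 0 := by
  have h := binForm_add k x y
  rwa [hU _ (U.add_mem hx hy), hU x hx, hU y hy, add_zero, zero_add, eq_comm] at h

theorem le_perp (hU : IsTotIso U) : U ≤ perp U := fun _ hx _ hy => hU.polar_eq_zero hy hx

theorem finrank_le (hU : IsTotIso U) : finrank (ZMod 2) U ≤ k := by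
  have h := Submodule.finrank_mono hU.le_perp
  have h2 := finrank_add_finrank_perp U
  omega

theorem perp_eq (hU : IsTotIso U) (h : finrank (ZMod 2) U = k) : perp U = U := by
  have h2 := finrank_add_finrank_perp U
  exact (Submodule.eq_of_le_of_finrank_le hU.le_perp (by omega)).symm

theorem mono (hU : IsTotIso U) (h : W ≤ U) : IsTotIso W := fun x hx => hU x (h hx)

theorem sup (hU : IsTotIso U) (hW : IsTotIso W) (h : W ≤ perp U) : IsTotIso (U ⊔ W) := by
  intro x hx
  obtain ⟨a, ha, b, hb, rfl⟩ := mem_sup.1 hx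
  rw [binForm_add, hU a ha, hW b hb, h hb a ha]
  simp

theorem eq_of_le (hU : finrank (ZMod 2) U = k) (hW : IsTotIso W) (h : U ≤ W) : U = W :=
  Submodule.eq_of_le_of_finrank_le h (hW.finrank_le.trans hU.ge)

end IsTotIso

theorem isTotIso_bot (k : ℕ) : IsTotIso (⊥ : Submodule (ZMod 2) (BinSpace k)) := by
  intro x hx
  rw [(mem_bot _).1 hx, map_zero]

theorem isTotIso_span_singleton {k : ℕ} {v : BinSpace k} (hv : binForm k v = 0) :
    IsTotIso (span (ZMod 2) {v}) := by
  intro x hx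
  obtain ⟨a, rfl⟩ := mem_span_singleton.1 hx
  rw [QuadraticMap.map_smul, hv, smul_zero]

theorem zmod_two_eq_one {a : ZMod 2} (h : a ≠ 0) : a = 1 := by
  revert a; decide

/-- A totally isotropic subspace meeting the maximal one `S` trivially and of dimension less
than `k` extends to a larger such subspace. -/
theorem exists_disjoint_isotropic_lt {k : ℕ} {S T : Submodule (ZMod 2) (BinSpace k)}
    (hS : IsTotIso S) (hSk : finrank (ZMod 2) S = k) (hT : IsTotIso T) (hTS : Disjoint T S)
    (hk : finrank (ZMod 2) T < k) : ∃ T', T < T' ∧ IsTotIso T' ∧ Disjoint T' S := by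
  have hperp : perp (perp T ⊓ S) = T ⊔ S := by rw [perp_inf, perp_perp, hS.perp_eq hSk]
  -- Otherwise T^⊥ = T + (T^⊥ ∩ S). As (T^⊥ ∩ S)^⊥ = T + S, the last summand has dimension k - dim
  -- T, so 2k - dim T ≤ k, against dim T < k.
  have hlt : ¬ perp T ≤ T ⊔ S := by
    intro hle
    have h1 : perp T ≤ T ⊔ (perp T ⊓ S) := by
      intro x hx
      obtain ⟨a, ha, b, hb, rfl⟩ := mem_sup.1 (hle hx)
      refine add_mem_sup ha ⟨?_, hb⟩
      have := (perp T).sub_mem hx (hT.le_perp ha)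
      rwa [add_sub_cancel_left] at this
    have h2 := Submodule.finrank_mono h1
    have h3 := Submodule.finrank_add_le_finrank_add_finrank T (perp T ⊓ S)
    have h4 := finrank_add_finrank_perp (perp T ⊓ S)
    have h5 := Submodule.finrank_sup_add_finrank_inf_eq T S
    rw [hTS.eq_bot, finrank_bot] at h5
    rw [hperp] at h4
    have h6 := finrank_add_finrank_perp T
    omega
  obtain ⟨v, hv, hvTS⟩ := SetLike.not_le_iff_exists.1 hlt
  obtain ⟨u, hu, huTS, hq⟩ : ∃ u ∈ perp T, u ∉ T ⊔ S ∧ binForm k u = 0 := by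
    by_cases hq : binForm k v = 0
    · exact ⟨v, hv, hvTS, hq⟩
    · rw [← hperp, mem_perp] at hvTS
      push Not at hvTS
      obtain ⟨s, ⟨hs, hsS⟩, hsv⟩ := hvTS
      -- Adding a singular s with polar value 1 against v changes q(v) = 1 into 0.
      refine ⟨s + v, (perp T).add_mem hs hv, ?_, ?_⟩
      · intro h
        have h' := (T ⊔ S).sub_mem h (le_sup_right (a := T) hsS)
        rw [add_sub_cancel_left, ← hperp] at h'
        exact hsv (h' s ⟨hs, hsS⟩)
      · rw [binForm_add, hS s hsS, zmod_two_eq_one hq, zmod_two_eq_one hsv]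
        decide
  have hle : span (ZMod 2) {u} ≤ perp T := by rwa [span_singleton_le_iff_mem]
  refine ⟨T ⊔ span (ZMod 2) {u}, ?_, hT.sup (isTotIso_span_singleton hq) hle, ?_⟩
  · refine lt_of_le_of_ne le_sup_left fun h => huTS (le_sup_left (a := T) ?_)
    rw [h]
    exact le_sup_right (a := T) (mem_span_singleton_self u)
  · rw [disjoint_def]
    intro x hx hxS
    obtain ⟨a, ha, b, hb, rfl⟩ := mem_sup.1 hx
    obtain ⟨c, rfl⟩ := mem_span_singleton.1 hb
    by_cases hc : c = 0
    · subst hc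
      rw [zero_smul, add_zero] at hxS ⊢
      exact disjoint_def.1 hTS a ha hxS
    · rw [zmod_two_eq_one hc, one_smul] at hxS
      exfalso
      apply huTS
      have := (T ⊔ S).sub_mem (le_sup_right (a := T) hxS) (le_sup_left (a := T) ha)
      rwa [add_sub_cancel_left] at this

/-- Every totally isotropic subspace meeting the maximal one `S` trivially lies in a
complement of `S` that is totally isotropic. -/
theorem exists_isotropic_complement {k : ℕ} {S C : Submodule (ZMod 2) (BinSpace k)}
    (hS : IsTotIso S) (hSk : finrank (ZMod 2) S = k) (hC : IsTotIso C) (hCS : Disjoint C S) :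
    ∃ T, C ≤ T ∧ IsTotIso T ∧ Disjoint T S ∧ finrank (ZMod 2) T = k := by
  induction h : k - finrank (ZMod 2) C using Nat.strong_induction_on generalizing C with
  | _ n ih =>
    subst h
    rcases lt_or_ge (finrank (ZMod 2) C) k with hlt | hge
    · obtain ⟨C', hCC', hC', hd⟩ := exists_disjoint_isotropic_lt hS hSk hC hCS hlt
      have := Submodule.finrank_lt_finrank_of_lt hCC'
      obtain ⟨T, h1, h2⟩ := ih _ (by omega) hC' hd rfl
      exact ⟨T, hCC'.le.trans h1, h2⟩
    · exact ⟨C, le_rfl, hC, hCS, le_antisymm hC.finrank_le hge⟩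

theorem isCompl_of_disjoint {k : ℕ} {S T : Submodule (ZMod 2) (BinSpace k)}
    (hSk : finrank (ZMod 2) S = k) (hTk : finrank (ZMod 2) T = k) (h : Disjoint S T) :
    IsCompl S T := by
  refine ⟨h, codisjoint_iff.2 (Submodule.eq_top_of_finrank_eq ?_)⟩
  have h5 := Submodule.finrank_sup_add_finrank_inf_eq S T
  rw [h.eq_bot, finrank_bot] at h5
  rw [finrank_binSpace]
  omega

/-- The pairing of two complementary maximal totally isotropic subspaces is perfect. -/
theorem exists_pairing_equiv {k : ℕ} {S T : Submodule (ZMod 2) (BinSpace k)}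
    (hS : IsTotIso S) (hSk : finrank (ZMod 2) S = k) (hTk : finrank (ZMod 2) T = k)
    (h : Disjoint S T) :
    ∃ e : T ≃ₗ[ZMod 2] Dual (ZMod 2) S, ∀ (t : T) (s : S), e t s = binPolar k t s := by
  let f : T →ₗ[ZMod 2] Dual (ZMod 2) S :=
    ((binPolar k).domRestrict₁₂ T S)
  have hf : Function.Injective f := by
    rw [injective_iff_map_eq_zero]
    intro t ht
    have h1 : (t : BinSpace k) ∈ perp S := fun s hs => by
      rw [binPolar_comm]; exact LinearMap.congr_fun ht ⟨s, hs⟩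
    rw [hS.perp_eq hSk] at h1
    exact Subtype.ext (disjoint_def.1 h _ h1 t.2)
  refine ⟨LinearEquiv.ofInjectiveOfFinrankEq f hf ?_, fun t s => rfl⟩
  rw [Subspace.dual_finrank_eq, hSk, hTk]

/-! ### Extension of isometries -/

/-- A linear isomorphism of maximal totally isotropic subspaces extends to an isometry that
carries a given totally isotropic complement to another. -/
theorem exists_isometry_extending {k : ℕ} {S T S' T' : Submodule (ZMod 2) (BinSpace k)}
    (hS : IsTotIso S) (hSk : finrank (ZMod 2) S = k) (hT : IsTotIso T)
    (hTk : finrank (ZMod 2) T = k) (h : Disjoint S T)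
    (hS' : IsTotIso S') (hSk' : finrank (ZMod 2) S' = k) (hT' : IsTotIso T')
    (hTk' : finrank (ZMod 2) T' = k) (h' : Disjoint S' T') (e : S ≃ₗ[ZMod 2] S') :
    ∃ g : (binForm k).IsometryEquiv (binForm k), (∀ s : S, g s = e s) ∧ ∀ t ∈ T, g t ∈ T' := by
  obtain ⟨p, hp⟩ := exists_pairing_equiv hS hSk hTk h
  obtain ⟨p', hp'⟩ := exists_pairing_equiv hS' hSk' hTk' h'
  -- The contragredient of `e` under the two pairings, which makes e ⊕ d preserve the polar form.
  let d : T ≃ₗ[ZMod 2] T' := p.trans (e.symm.dualMap.trans p'.symm)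
  have hd : ∀ (t : T) (s : S), binPolar k (d t) (e s) = binPolar k t s := by
    intro t s
    rw [← hp', ← hp]
    simp [d]
  have hc := isCompl_of_disjoint hSk hTk h
  have hc' := isCompl_of_disjoint hSk' hTk' h'
  let G : BinSpace k ≃ₗ[ZMod 2] BinSpace k :=
    ((prodEquivOfIsCompl S T hc).symm.trans (e.prodCongr d)).trans (prodEquivOfIsCompl S' T' hc')
  have hG : ∀ (s : S) (t : T), G (s + t) = e s + d t := by
    intro s t
    have : (prodEquivOfIsCompl S T hc).symm (s + t) = (s, t) := by
      rw [LinearEquiv.symm_apply_eq]; rfl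
    simp [G, this]
  refine ⟨⟨G, ?_⟩, ?_, ?_⟩
  · intro x
    obtain ⟨s, hs, t, ht, rfl⟩ := mem_sup.1 (hc.sup_eq_top ▸ mem_top : x ∈ S ⊔ T)
    have := hG ⟨s, hs⟩ ⟨t, ht⟩
    change binForm k (G (s + t)) = _
    rw [this, binForm_add, binForm_add, hS s hs, hT t ht, hS' _ (e _).2, hT' _ (d _).2,
      binPolar_comm, hd, binPolar_comm]
  · intro s
    have := hG s 0
    simp only [map_zero, ZeroMemClass.coe_zero, add_zero] at this
    exact this
  · intro t ht
    have := hG 0 ⟨t, ht⟩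
    simp only [map_zero, ZeroMemClass.coe_zero, zero_add] at this
    change G t ∈ T'
    rw [this]
    exact (d _).2

/-- Subspaces of equal dimension correspond under some linear isomorphism. -/
theorem exists_linearEquiv_map_eq {K V V' : Type*} [Field K] [AddCommGroup V] [Module K V]
    [AddCommGroup V'] [Module K V'] [FiniteDimensional K V] [FiniteDimensional K V']
    (hV : finrank K V = finrank K V') (I : Submodule K V) (I' : Submodule K V')
    (hI : finrank K I = finrank K I') :
    ∃ e : V ≃ₗ[K] V', ∀ x, e x ∈ I' ↔ x ∈ I := by
  obtain ⟨D, hD⟩ := I.exists_isCompl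
  obtain ⟨D', hD'⟩ := I'.exists_isCompl
  have h1 := Submodule.finrank_add_eq_of_isCompl hD
  have h2 := Submodule.finrank_add_eq_of_isCompl hD'
  have hDD : finrank K D = finrank K D' := by omega
  let a := LinearEquiv.ofFinrankEq I I' hI
  let b := LinearEquiv.ofFinrankEq D D' hDD
  let e : V ≃ₗ[K] V' :=
    ((prodEquivOfIsCompl I D hD).symm.trans (a.prodCongr b)).trans (prodEquivOfIsCompl I' D' hD')
  have he : I.map (e : V →ₗ[K] V') ≤ I' := by
    rintro _ ⟨x, hx, rfl⟩
    have : (prodEquivOfIsCompl I D hD).symm x = (⟨x, hx⟩, 0) := by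
      rw [LinearEquiv.symm_apply_eq]; simp
    simp [e, this]
  have he' : I.map (e : V →ₗ[K] V') = I' :=
    Submodule.eq_of_le_of_finrank_eq he ((LinearEquiv.finrank_map_eq e I).trans hI)
  refine ⟨e, fun x => ?_⟩
  rw [← he', ← LinearEquiv.coe_toLinearMap, Submodule.mem_map]
  exact ⟨fun ⟨y, hy, hxy⟩ => e.injective hxy ▸ hy, fun hx => ⟨x, hx, rfl⟩⟩

/-! ### The group action and its transitivity -/

theorem interCard_eq_two_pow {k w : ℕ} (S S' : TotIso k w) :
    interCard S S' = 2 ^ finrank (ZMod 2) (S.1 ⊓ S'.1 : Submodule (ZMod 2) (BinSpace k)) := by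
  rw [interCard, Module.natCard_eq_pow_finrank (K := ZMod 2), Nat.card_zmod]

theorem isoMove_eq_of_mem {k w : ℕ} (g : (binForm k).IsometryEquiv (binForm k))
    {S S' : TotIso k w} (h : ∀ x ∈ S.1, g x ∈ S'.1) : isoMove g S = S' := by
  refine Subtype.ext (Submodule.eq_of_le_of_finrank_eq ?_ ((isoMove g S).2.1.trans S'.2.1.symm))
  rintro _ ⟨x, hx, rfl⟩
  exact h x hx

theorem isoMove_trans {k w : ℕ} (g h : (binForm k).IsometryEquiv (binForm k)) (S : TotIso k w) :
    isoMove (g.trans h) S = isoMove h (isoMove g S) :=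
  isoMove_eq_of_mem _ fun x hx => ⟨g x, ⟨x, hx, rfl⟩, rfl⟩

theorem isoMove_symm_isoMove {k w : ℕ} (g : (binForm k).IsometryEquiv (binForm k))
    (S : TotIso k w) : isoMove g.symm (isoMove g S) = S := by
  rw [← isoMove_trans]
  refine isoMove_eq_of_mem _ fun x hx => ?_
  change g.symm (g x) ∈ _
  rwa [QuadraticMap.IsometryEquiv.symm_apply_apply]

theorem isoMove_isoMove_symm {k w : ℕ} (g : (binForm k).IsometryEquiv (binForm k))
    (S : TotIso k w) : isoMove g (isoMove g.symm S) = S := by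
  rw [← isoMove_trans]
  refine isoMove_eq_of_mem _ fun x hx => ?_
  change g (g.symm x) ∈ _
  rwa [QuadraticMap.IsometryEquiv.apply_symm_apply]

/-- The permutation of `X_w` given by an isometry. -/
def isoPerm {k : ℕ} (w : ℕ) (g : (binForm k).IsometryEquiv (binForm k)) :
    TotIso k w ≃ TotIso k w where
  toFun := isoMove g
  invFun := isoMove g.symm
  left_inv := isoMove_symm_isoMove g
  right_inv := isoMove_isoMove_symm g

theorem mem_isoMove {k w : ℕ} (g : (binForm k).IsometryEquiv (binForm k)) (S : TotIso k w)
    (x : BinSpace k) : g x ∈ (isoMove g S).1 ↔ x ∈ S.1 := by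
  refine ⟨?_, fun hx => ⟨x, hx, rfl⟩⟩
  rintro ⟨y, hy, hxy⟩
  rwa [← EquivLike.injective g hxy]

theorem interCard_isoMove {k w : ℕ} (g : (binForm k).IsometryEquiv (binForm k))
    (S S' : TotIso k w) : interCard (isoMove g S) (isoMove g S') = interCard S S' := by
  refine (Nat.card_congr ((EquivLike.toEquiv g).subtypeEquiv fun x => ?_)).symm
  change _ ↔ g x ∈ (isoMove g S).1 ⊓ (isoMove g S').1
  rw [mem_inf, mem_inf, mem_isoMove, mem_isoMove]

/-- The vectors `(a, 0)` form a maximal totally isotropic subspace. -/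
theorem exists_isTotIso_finrank_eq (k : ℕ) :
    ∃ M : Submodule (ZMod 2) (BinSpace k), IsTotIso M ∧ finrank (ZMod 2) M = k := by
  refine ⟨LinearMap.range (LinearMap.inl (ZMod 2) (Fin k → ZMod 2) (Fin k → ZMod 2)), ?_, ?_⟩
  · rintro _ ⟨x, rfl⟩
    simp [binForm_apply]
  · rw [LinearMap.finrank_range_of_inj LinearMap.inl_injective, finrank_fin_fun]

/-- For any maximal isotropic E, the isotropic subspace U + (E ∩ U^⊥) has dimension k, because (E ∩
U^⊥)^⊥ = E + U. -/
theorem exists_maximal_isotropic_ge {k : ℕ} {U : Submodule (ZMod 2) (BinSpace k)}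
    (hU : IsTotIso U) : ∃ M, U ≤ M ∧ IsTotIso M ∧ finrank (ZMod 2) M = k := by
  obtain ⟨E, hE, hEk⟩ := exists_isTotIso_finrank_eq k
  have hM : IsTotIso (U ⊔ (E ⊓ perp U)) := hU.sup (hE.mono inf_le_left) inf_le_right
  refine ⟨_, le_sup_left, hM, le_antisymm hM.finrank_le ?_⟩
  have h1 := Submodule.finrank_sup_add_finrank_inf_eq U (E ⊓ perp U)
  have h2 : U ⊓ (E ⊓ perp U) = E ⊓ U := by
    refine le_antisymm (fun x hx => ⟨hx.2.1, hx.1⟩) fun x hx => ⟨hx.2, hx.1, hU.le_perp hx.2⟩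
  have h3 := finrank_add_finrank_perp (E ⊓ perp U)
  rw [perp_inf, perp_perp, hE.perp_eq hEk] at h3
  have h4 := Submodule.finrank_sup_add_finrank_inf_eq E U
  rw [h2] at h1
  omega

/-- The orthogonal group is transitive on totally isotropic subspaces of a given dimension. -/
theorem exists_isoMove_eq {k w : ℕ} (S S' : TotIso k w) :
    ∃ g : (binForm k).IsometryEquiv (binForm k), isoMove g S = S' := by
  obtain ⟨M, hSM, hM, hMk⟩ := exists_maximal_isotropic_ge (U := S.1) S.2.2
  obtain ⟨M', hSM', hM', hMk'⟩ := exists_maximal_isotropic_ge (U := S'.1) S'.2.2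
  obtain ⟨T, -, hT, hTM, hTk⟩ :=
    exists_isotropic_complement hM hMk (isTotIso_bot k) disjoint_bot_left
  obtain ⟨T', -, hT', hTM', hTk'⟩ :=
    exists_isotropic_complement hM' hMk' (isTotIso_bot k) disjoint_bot_left
  obtain ⟨e, he⟩ := exists_linearEquiv_map_eq (hMk.trans hMk'.symm) (S.1.comap M.subtype)
    (S'.1.comap M'.subtype) (by
      rw [(comapSubtypeEquivOfLe hSM).finrank_eq, (comapSubtypeEquivOfLe hSM').finrank_eq,
        S.2.1, S'.2.1])
  obtain ⟨g, hg, -⟩ := exists_isometry_extending hM hMk hT hTk hTM.symm hM' hMk' hT' hTk'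
    hTM'.symm e
  refine ⟨g, isoMove_eq_of_mem g fun x hx => ?_⟩
  rw [hg ⟨x, hSM hx⟩]
  exact (he ⟨x, hSM hx⟩).2 hx

/-- A maximal totally isotropic `S₂` is recovered from its intersection with `S₁` and a suitable
isotropic complement of `S₁`. -/
theorem exists_complement_adapted {k : ℕ} (S₁ S₂ : TotIso k k) :
    ∃ T : Submodule (ZMod 2) (BinSpace k), IsTotIso T ∧ finrank (ZMod 2) T = k ∧
      Disjoint S₁.1 T ∧ S₂.1 = (S₁.1 ⊓ S₂.1) ⊔ (T ⊓ perp (S₁.1 ⊓ S₂.1)) := by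
  -- A complement of S₁ ∩ S₂ inside S₂ avoids S₁, hence extends to an isotropic complement T of S₁.
  obtain ⟨D, hD⟩ := ((S₁.1 ⊓ S₂.1).comap S₂.1.subtype).exists_isCompl
  have hS₂ : IsTotIso S₂.1 := S₂.2.2
  have hC : IsTotIso (D.map S₂.1.subtype) := hS₂.mono (map_subtype_le _ _)
  have hdisj : Disjoint (D.map S₂.1.subtype) S₁.1 := by
    rw [disjoint_def]
    rintro _ ⟨x, hx, rfl⟩ hx1
    have := disjoint_def.1 hD.disjoint x ⟨hx1, x.2⟩ hx
    rw [this, map_zero]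
  obtain ⟨T, hCT, hT, hTS, hTk⟩ := exists_isotropic_complement S₁.2.2 S₁.2.1 hC hdisj
  refine ⟨T, hT, hTk, hTS.symm, ?_⟩
  refine IsTotIso.eq_of_le S₂.2.1
    ((hS₂.mono inf_le_right).sup (hT.mono inf_le_left) inf_le_right) fun x hx => ?_
  obtain ⟨a, ha, b, hb, hab⟩ := mem_sup.1 (hD.sup_eq_top ▸ mem_top :
    (⟨x, hx⟩ : S₂.1) ∈ (S₁.1 ⊓ S₂.1).comap S₂.1.subtype ⊔ D)
  have : x = a + b := (congrArg Subtype.val hab).symm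
  rw [this]
  refine add_mem_sup ha ⟨hCT ⟨b, hb, rfl⟩, fun y hy => ?_⟩
  exact hS₂.polar_eq_zero hy.2 b.2

/-- The orthogonal group is transitive on pairs of maximal totally isotropic subspaces with a
given size of intersection. -/
theorem exists_isoMove_pair_eq {k : ℕ} {S₁ S₂ S₁' S₂' : TotIso k k}
    (h : interCard S₁ S₂ = interCard S₁' S₂') :
    ∃ g : (binForm k).IsometryEquiv (binForm k), isoMove g S₁ = S₁' ∧ isoMove g S₂ = S₂' := by
  rw [interCard_eq_two_pow, interCard_eq_two_pow] at h
  have h := Nat.pow_right_injective le_rfl h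
  obtain ⟨T, hT, hTk, hd, hS₂⟩ := exists_complement_adapted S₁ S₂
  obtain ⟨T', hT', hTk', hd', hS₂'⟩ := exists_complement_adapted S₁' S₂'
  obtain ⟨e, he⟩ := exists_linearEquiv_map_eq (S₁.2.1.trans S₁'.2.1.symm)
    ((S₁.1 ⊓ S₂.1).comap S₁.1.subtype) ((S₁'.1 ⊓ S₂'.1).comap S₁'.1.subtype) (by
      rw [(comapSubtypeEquivOfLe inf_le_left).finrank_eq,
        (comapSubtypeEquivOfLe inf_le_left).finrank_eq, h])
  obtain ⟨g, hg, hgT⟩ := exists_isometry_extending S₁.2.2 S₁.2.1 hT hTk hd S₁'.2.2 S₁'.2.1 hT'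
    hTk' hd' e
  have hI : ∀ x ∈ S₁.1, g x ∈ S₁'.1 ⊓ S₂'.1 ↔ x ∈ S₁.1 ⊓ S₂.1 := fun x hx => by
    rw [hg ⟨x, hx⟩]
    exact he ⟨x, hx⟩
  have h1 : ∀ x ∈ S₁.1, g x ∈ S₁'.1 := fun x hx => by
    rw [hg ⟨x, hx⟩]
    exact (e _).2
  have hS₁ := isoMove_eq_of_mem g h1
  refine ⟨g, hS₁, isoMove_eq_of_mem g fun x hx => ?_⟩
  rw [hS₂] at hx
  obtain ⟨a, ha, b, ⟨hbT, hb⟩, rfl⟩ := mem_sup.1 hx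
  rw [map_add, hS₂']
  refine add_mem_sup ((hI a ha.1).2 ha) ⟨hgT b hbT, fun y hy => ?_⟩
  obtain ⟨z, hz, rfl⟩ : ∃ z ∈ S₁.1, g z = y := by
    have := hy.1
    rw [← hS₁] at this
    exact this
  have h3 := hb z ((hI z hz).1 hy)
  have h4 := binForm_add k (g z) (g b)
  rw [← map_add, g.map_app, g.map_app, g.map_app, binForm_add] at h4
  rw [← h3]
  exact (add_left_cancel h4).symm

/-! ### Reflections and parity -/

/-- The reflection in a nonsingular vector. -/
noncomputable def binReflection {k : ℕ} (v : BinSpace k) (hv : binForm k v = 1) :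
    (binForm k).IsometryEquiv (binForm k) where
  toLinearEquiv := LinearEquiv.ofInvolutive
    (LinearMap.id + ((binPolar k).flip v).smulRight v) (fun x => by
      have h : v + v = 0 := by ext <;> exact CharTwo.add_self_eq_zero (R := ZMod 2) _
      have hs : (binPolar k).flip v v = 0 := binPolar_self k v
      simp only [LinearMap.add_apply, LinearMap.id_apply, LinearMap.smulRight_apply, map_add,
        map_smul, hs, zero_smul, add_zero]
      rw [add_assoc, ← smul_add, h, smul_zero, add_zero])
  map_app' x := by
    change binForm k (x + binPolar k x v • v) = _
    rw [binForm_add, QuadraticMap.map_smul, hv, map_smul, smul_eq_mul, smul_eq_mul, mul_one,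
      add_assoc, CharTwo.add_self_eq_zero, add_zero]

theorem binReflection_apply {k : ℕ} (v : BinSpace k) (hv : binForm k v = 1) (x : BinSpace k) :
    binReflection v hv x = x + binPolar k x v • v := rfl

theorem binReflection_binReflection {k : ℕ} (v : BinSpace k) (hv : binForm k v = 1)
    (x : BinSpace k) : binReflection v hv (binReflection v hv x) = x :=
  (binReflection v hv).toLinearEquiv.left_inv x

theorem isoMove_binReflection_self {k w : ℕ} (v : BinSpace k) (hv : binForm k v = 1)
    (S : TotIso k w) : isoMove (binReflection v hv) (isoMove (binReflection v hv) S) = S := by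
  rw [← isoMove_trans]
  refine isoMove_eq_of_mem _ fun x hx => ?_
  change binReflection v hv (binReflection v hv x) ∈ _
  rwa [binReflection_binReflection]

theorem binPolar_binReflection {k : ℕ} (v : BinSpace k) (hv : binForm k v = 1)
    (x : BinSpace k) : binPolar k (binReflection v hv x) v = binPolar k x v := by
  rw [binReflection_apply, map_add, map_smul, LinearMap.add_apply, LinearMap.smul_apply,
    binPolar_self, smul_zero, add_zero]

theorem finrank_inf_ker_add_one {K V : Type*} [Field K] [AddCommGroup V] [Module K V]
    [FiniteDimensional K V] (I : Submodule K V) (f : Dual K V) {x : V} (hx : x ∈ I)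
    (hf : f x ≠ 0) : finrank K (I ⊓ LinearMap.ker f : Submodule K V) + 1 = finrank K I := by
  have h : f.domRestrict I ≠ 0 := fun h => hf (LinearMap.congr_fun h ⟨x, hx⟩)
  rw [← Module.Dual.finrank_ker_add_one_of_ne_zero h, LinearMap.ker_domRestrict,
    ← finrank_map_subtype_eq I, map_comap_subtype]

/-- An s in S not orthogonal to v moves to s + v, which is not in S₀, since x is orthogonal to s and
to S₀ but not to v. So the new intersection is the hyperplane of S ∩ S₀ orthogonal to v. -/
theorem finrank_reflection_inf_add_one {k : ℕ} {v : BinSpace k} (hv : binForm k v = 1)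
    (S S₀ : TotIso k k) {x : BinSpace k} (hx : x ∈ S.1 ⊓ S₀.1) (hxv : binPolar k x v ≠ 0) :
    finrank (ZMod 2) ((isoMove (binReflection v hv) S).1 ⊓ S₀.1 :
      Submodule (ZMod 2) (BinSpace k)) + 1 =
    finrank (ZMod 2) (S.1 ⊓ S₀.1 : Submodule (ZMod 2) (BinSpace k)) := by
  rw [← finrank_inf_ker_add_one (S.1 ⊓ S₀.1) ((binPolar k).flip v) hx hxv]
  refine congrArg (fun U : Submodule (ZMod 2) (BinSpace k) => finrank (ZMod 2) U + 1) ?_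
  have hS : IsTotIso S.1 := S.2.2
  have hS₀ : IsTotIso S₀.1 := S₀.2.2
  ext y
  constructor
  · rintro ⟨⟨s, hs, rfl⟩, hy⟩
    change binReflection v hv s ∈ S₀.1 at hy
    change binReflection v hv s ∈ _
    by_cases hsv : binPolar k s v = 0
    · have : binReflection v hv s = s := by
        rw [binReflection_apply, hsv, zero_smul, add_zero]
      rw [this] at hy ⊢
      exact ⟨⟨hs, hy⟩, hsv⟩
    · exfalso
      rw [binReflection_apply, zmod_two_eq_one hsv, one_smul] at hy
      apply hxv
      have h1 := hS₀.polar_eq_zero hx.2 hy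
      rwa [map_add, hS.polar_eq_zero hx.1 hs, zero_add] at h1
  · rintro ⟨⟨hyS, hy⟩, hyv⟩
    refine ⟨⟨y, hyS, ?_⟩, hy⟩
    change binReflection v hv y = y
    have hyv : binPolar k y v = 0 := hyv
    rw [binReflection_apply, hyv, zero_smul, add_zero]

/-- Reflections change the parity of the dimension of the intersection of two maximal totally
isotropic subspaces. -/
theorem neg_one_pow_finrank_reflection_inf {k : ℕ} {v : BinSpace k} (hv : binForm k v = 1)
    (S S₀ : TotIso k k) :
    (-1 : ℂ) ^ finrank (ZMod 2) ((isoMove (binReflection v hv) S).1 ⊓ S₀.1 :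
      Submodule (ZMod 2) (BinSpace k)) =
    -(-1 : ℂ) ^ finrank (ZMod 2) (S.1 ⊓ S₀.1 : Submodule (ZMod 2) (BinSpace k)) := by
  have hS : IsTotIso S.1 := S.2.2
  have hS₀ : IsTotIso S₀.1 := S₀.2.2
  by_cases h : ∃ x ∈ S.1 ⊓ S₀.1, binPolar k x v ≠ 0
  · obtain ⟨x, hx, hxv⟩ := h
    rw [← finrank_reflection_inf_add_one hv S S₀ hx hxv, pow_succ]
    ring
  · push Not at h
    have hvm : v ∈ perp (S.1 ⊓ S₀.1) := h
    -- Now v = a + b with a in S and b in S₀, and the reflection sends a to b. Thus b lies in the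
    -- reflected intersection and is not orthogonal to v: the first case applies to the image of S.
    rw [perp_inf, hS.perp_eq S.2.1, hS₀.perp_eq S₀.2.1] at hvm
    obtain ⟨a, ha, b, hb, rfl⟩ := mem_sup.1 hvm
    have hab : binPolar k a b = 1 := by
      rw [← hv, binForm_add, hS a ha, hS₀ b hb, zero_add, zero_add]
    have hav : binPolar k a (a + b) = 1 := by rw [map_add, binPolar_self, hab, zero_add]
    have hr : binReflection (a + b) hv a = b := by
      have h2 : a + a = 0 := by ext <;> exact CharTwo.add_self_eq_zero (R := ZMod 2) _
      rw [binReflection_apply, hav, one_smul, ← add_assoc, h2, zero_add]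
    have hbv : binPolar k b (a + b) ≠ 0 := by
      have h3 := binPolar_binReflection (a + b) hv a
      rw [hr, hav] at h3
      rw [h3]
      exact one_ne_zero
    have := finrank_reflection_inf_add_one hv (isoMove (binReflection (a + b) hv) S) S₀
      (x := b) ⟨⟨a, ha, hr⟩, hb⟩ hbv
    rw [isoMove_binReflection_self] at this
    rw [← this, pow_succ]
    ring

/-- The orthogonal complement of a subspace of dimension less than `k` has a nonsingular vector. -/
theorem exists_nonsingular_mem_perp {k : ℕ} {U : Submodule (ZMod 2) (BinSpace k)}
    (hU : finrank (ZMod 2) U < k) : ∃ v ∈ perp U, binForm k v = 1 := by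
  by_contra! h
  have hp : IsTotIso (perp U) := fun x hx => by
    by_contra hne
    exact h x hx (zmod_two_eq_one hne)
  have h1 := hp.finrank_le
  have h2 := finrank_add_finrank_perp U
  omega

/-! ### Tuple indicators and the sum of squares -/

open Classical in
/-- The indicator of the subspaces containing all vectors of the tuple `T`. -/
noncomputable def tupleInd {k w t : ℕ} (T : Fin t → BinSpace k) (S : TotIso k w) : ℂ :=
  if ∀ i, T i ∈ S.1 then 1 else 0

theorem sum_tupleInd_mul_tupleInd {k w : ℕ} (t : ℕ) (S S' : TotIso k w) :
    ∑ T : Fin t → BinSpace k, tupleInd T S * tupleInd T S' = (interCard S S' : ℂ) ^ t := by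
  classical
  have h : ∀ T : Fin t → BinSpace k, tupleInd T S * tupleInd T S' =
      if ∀ i, T i ∈ S.1 ⊓ S'.1 then (1 : ℂ) else 0 := by
    intro T
    simp only [tupleInd, mem_inf, forall_and, ite_and, mul_ite, mul_one, mul_zero]
    split_ifs <;> rfl
  simp only [h, Finset.sum_boole]
  rw [interCard, ← Nat.cast_pow]
  congr 1
  rw [← Fintype.card_subtype, ← Nat.card_eq_fintype_card,
    Nat.card_congr (Equiv.subtypePiEquivPi (p := fun _ x => x ∈ S.1 ⊓ S'.1)), Nat.card_fun,
    Nat.card_eq_fintype_card (α := Fin t), Fintype.card_fin]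

open Classical in
/-- The number of members of `A` containing the tuple `T`. -/
noncomputable def tupleCount {k w t : ℕ} (A : Finset (TotIso k w)) (T : Fin t → BinSpace k) : ℝ :=
  ((A.filter fun S => ∀ i, T i ∈ S.1).card : ℕ)

theorem sum_tupleInd {k w t : ℕ} (A : Finset (TotIso k w)) (T : Fin t → BinSpace k) :
    ∑ S ∈ A, tupleInd T S = (tupleCount A T : ℂ) := by
  classical
  simp [tupleInd, tupleCount]

theorem sum_tupleCount_mul {k w : ℕ} (t : ℕ) (A A' : Finset (TotIso k w)) :
    ∑ T : Fin t → BinSpace k, tupleCount A T * tupleCount A' T =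
      ∑ S ∈ A, ∑ S' ∈ A', (interCard S S' : ℝ) ^ t := by
  apply Complex.ofReal_injective
  push_cast
  simp only [← sum_tupleInd, Finset.sum_mul_sum, ← sum_tupleInd_mul_tupleInd]
  rw [Finset.sum_comm]
  exact Finset.sum_congr rfl fun _ _ => Finset.sum_comm

theorem sum_interCard_pow_eq {k w : ℕ} (t : ℕ) (S₁ S₂ : TotIso k w) :
    ∑ S', (interCard S₁ S' : ℝ) ^ t = ∑ S', (interCard S₂ S' : ℝ) ^ t := by
  obtain ⟨g, rfl⟩ := exists_isoMove_eq S₁ S₂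
  refine Fintype.sum_equiv (isoPerm w g) _ _ fun S' => ?_
  change _ = (interCard (isoMove g S₁) (isoMove g S') : ℝ) ^ t
  rw [interCard_isoMove]

/-- The excess of the moment of `A` over the moment of the whole space is a sum of squares. -/
theorem interMoment_sub_interMoment_univ {k w : ℕ} (t : ℕ) {A : Finset (TotIso k w)}
    (hA : A.Nonempty) :
    interMoment t A - interMoment t (Finset.univ : Finset (TotIso k w)) =
      ∑ T : Fin t → BinSpace k, (tupleCount A T / A.card -
        tupleCount (Finset.univ : Finset (TotIso k w)) T /
          (Finset.univ : Finset (TotIso k w)).card) ^ 2 := by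
  obtain ⟨S₀, hS₀⟩ := hA
  have hA0 : (A.card : ℝ) ≠ 0 := Nat.cast_ne_zero.2 (Finset.card_ne_zero_of_mem hS₀)
  have hX0 : ((Finset.univ : Finset (TotIso k w)).card : ℝ) ≠ 0 :=
    Nat.cast_ne_zero.2 (Finset.card_ne_zero_of_mem (Finset.mem_univ S₀))
  -- By transitivity the cross term with the whole space depends on A' only through its size.
  have hrow : ∀ A' : Finset (TotIso k w), ∑ T : Fin t → BinSpace k,
      tupleCount A' T * tupleCount (Finset.univ : Finset (TotIso k w)) T =
        A'.card * ∑ S', (interCard S₀ S' : ℝ) ^ t := by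
    intro A'
    rw [sum_tupleCount_mul, Finset.sum_congr rfl fun S _ => sum_interCard_pow_eq t S S₀,
      Finset.sum_const, nsmul_eq_mul]
  have hAA := sum_tupleCount_mul t A A
  have hXX := sum_tupleCount_mul t (Finset.univ : Finset (TotIso k w)) Finset.univ
  rw [interMoment, interMoment, ← hAA, ← hXX]
  simp only [sub_sq, div_pow, Finset.sum_add_distrib, Finset.sum_sub_distrib]
  have h1 : ∀ (a x : ℝ), 2 * (a / A.card) * (x / (Finset.univ : Finset (TotIso k w)).card) =
      2 / (A.card * (Finset.univ : Finset (TotIso k w)).card) * (a * x) := by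
    intro a x
    field_simp
  simp only [h1, ← Finset.mul_sum, hrow, pow_two (tupleCount _ _), ← Finset.sum_div]
  field_simp
  ring

theorem interMoment_univ_le {k w : ℕ} (t : ℕ) {A : Finset (TotIso k w)} (hA : A.Nonempty) :
    interMoment t (Finset.univ : Finset (TotIso k w)) ≤ interMoment t A := by
  rw [← sub_nonneg, interMoment_sub_interMoment_univ t hA]
  positivity

/-- The average of a function over `A` agrees with the average over the whole space. -/
def AverageEq {k w : ℕ} (A : Finset (TotIso k w)) (f : TotIso k w → ℂ) : Prop :=
  (∑ S ∈ A, f S) / A.card = (∑ S, f S) / (Finset.univ : Finset (TotIso k w)).card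

theorem interMoment_eq_univ_iff {k w : ℕ} (t : ℕ) {A : Finset (TotIso k w)} (hA : A.Nonempty) :
    interMoment t A = interMoment t (Finset.univ : Finset (TotIso k w)) ↔
      ∀ T : Fin t → BinSpace k, AverageEq A (tupleInd T) := by
  rw [← sub_eq_zero, interMoment_sub_interMoment_univ t hA,
    Finset.sum_eq_zero_iff_of_nonneg fun _ _ => sq_nonneg _]
  refine ⟨fun h T => ?_, fun h T _ => ?_⟩
  · have := sub_eq_zero.1 (pow_eq_zero_iff two_ne_zero |>.1 (h T (Finset.mem_univ T)))
    rw [AverageEq, sum_tupleInd, sum_tupleInd]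
    exact_mod_cast congrArg Complex.ofReal this
  · have := h T
    rw [AverageEq, sum_tupleInd, sum_tupleInd] at this
    rw [pow_eq_zero_iff two_ne_zero, sub_eq_zero]
    exact_mod_cast this

/-! ### The strictly increasing filtration by tuple length -/

/-- The span of the indicators of `t`-tuples. -/
noncomputable def tupleSpan (k t : ℕ) : Submodule ℂ (TotIso k k → ℂ) :=
  span ℂ (Set.range fun T : Fin t → BinSpace k => tupleInd T)

theorem tupleInd_mem_tupleSpan {k t : ℕ} (T : Fin t → BinSpace k) :
    tupleInd T ∈ tupleSpan k t := subset_span ⟨T, rfl⟩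

theorem tupleInd_cons {k w t : ℕ} (x : BinSpace k) (T : Fin t → BinSpace k) (S : TotIso k w) :
    tupleInd (Fin.cons x T : Fin (t + 1) → BinSpace k) S =
      tupleInd (fun _ : Fin 1 => x) S * tupleInd T S := by
  have h : (∀ i, (Fin.cons x T : Fin (t + 1) → BinSpace k) i ∈ S.1) ↔
      x ∈ S.1 ∧ ∀ i, T i ∈ S.1 :=
    Fin.forall_fin_succ (P := fun i => (Fin.cons x T : Fin (t + 1) → BinSpace k) i ∈ S.1)
  classical
  have h' : tupleInd (Fin.cons x T : Fin (t + 1) → BinSpace k) S =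
      if x ∈ S.1 ∧ ∀ i, T i ∈ S.1 then 1 else 0 := if_congr h rfl rfl
  rw [h']
  by_cases hx : x ∈ S.1 <;> simp [tupleInd, hx]

theorem tupleSpan_le_succ (k t : ℕ) : tupleSpan k t ≤ tupleSpan k (t + 1) := by
  refine span_le.2 ?_
  rintro _ ⟨T, rfl⟩
  -- Padding with the zero vector, which every subspace contains.
  have : tupleInd (w := k) T = tupleInd (Fin.cons 0 T : Fin (t + 1) → BinSpace k) := by
    funext S
    rw [tupleInd_cons]
    simp [tupleInd]
  change tupleInd T ∈ _
  rw [this]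
  exact tupleInd_mem_tupleSpan _

theorem tupleSpan_mono (k : ℕ) : Monotone (tupleSpan k) :=
  monotone_nat_of_le_succ (tupleSpan_le_succ k)

theorem mul_tupleInd_mem {k t : ℕ} (x : BinSpace k) {f : TotIso k k → ℂ}
    (hf : f ∈ tupleSpan k t) : tupleInd (fun _ : Fin 1 => x) * f ∈ tupleSpan k (t + 1) := by
  induction hf using span_induction with
  | mem f hf =>
    obtain ⟨T, rfl⟩ := hf
    have : tupleInd (fun _ : Fin 1 => x) * tupleInd T =
        tupleInd (w := k) (Fin.cons x T : Fin (t + 1) → BinSpace k) :=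
      funext fun S => (tupleInd_cons x T S).symm
    change tupleInd (fun _ : Fin 1 => x) * tupleInd T ∈ _
    rw [this]
    exact tupleInd_mem_tupleSpan _
  | zero => rw [mul_zero]; exact zero_mem _
  | add f g _ _ hf hg => rw [mul_add]; exact add_mem hf hg
  | smul c f _ hf => rw [mul_smul_comm]; exact smul_mem _ c hf

/-- Each level is generated from the previous one by multiplying with one-vector indicators, so a
stall propagates. -/
theorem tupleSpan_step {k t : ℕ} (h : tupleSpan k (t + 1) ≤ tupleSpan k t) :
    tupleSpan k (t + 2) ≤ tupleSpan k (t + 1) := by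
  refine span_le.2 ?_
  rintro _ ⟨T, rfl⟩
  have : tupleInd (w := k) T =
      tupleInd (fun _ : Fin 1 => T 0) * tupleInd (fun i : Fin (t + 1) => T i.succ) := by
    funext S
    conv_lhs => rw [← Fin.cons_self_tail T]
    exact tupleInd_cons _ _ S
  change tupleInd T ∈ _
  rw [this]
  exact mul_tupleInd_mem _ (h (tupleInd_mem_tupleSpan _))

theorem exists_tupleInd_eq_single {k : ℕ} (S₀ : TotIso k k) :
    ∃ T : Fin k → BinSpace k, ∀ S : TotIso k k, tupleInd T S = open Classical in
      if S = S₀ then 1 else 0 := by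
  let b := Module.finBasisOfFinrankEq (ZMod 2) S₀.1 S₀.2.1
  refine ⟨fun i => b i, fun S => ?_⟩
  classical
  refine if_congr ?_ rfl rfl
  refine ⟨fun h => ?_, ?_⟩
  · refine Subtype.ext (IsTotIso.eq_of_le S₀.2.1 S.2.2 fun x hx => ?_).symm
    have hx' : (⟨x, hx⟩ : S₀.1) ∈ span (ZMod 2) (Set.range b) := by
      rw [b.span_eq]; trivial
    have h2 : span (ZMod 2) (Set.range b) ≤ S.1.comap S₀.1.subtype := by
      rw [span_le]
      rintro _ ⟨i, rfl⟩
      exact h i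
    exact h2 hx'
  · rintro rfl i
    exact (b i).2

theorem tupleSpan_self_eq_top (k : ℕ) : tupleSpan k k = ⊤ := by
  classical
  rw [eq_top_iff]
  intro f _
  rw [← Finset.univ_sum_single f]
  refine sum_mem fun S₀ _ => ?_
  obtain ⟨T, hT⟩ := exists_tupleInd_eq_single S₀
  have : (Pi.single S₀ (f S₀) : TotIso k k → ℂ) = f S₀ • tupleInd T := by
    funext S
    rw [Pi.smul_apply, hT, Pi.single_apply]
    split_ifs <;> simp_all
  rw [this]
  exact smul_mem _ _ (tupleInd_mem_tupleSpan T)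

theorem nonempty_totIso (k : ℕ) : Nonempty (TotIso k k) := by
  obtain ⟨M, hM, hMk⟩ := exists_isTotIso_finrank_eq k
  exact ⟨⟨M, hMk, hM⟩⟩

/-- The parity of the dimension of `S ∩ S₀` is orthogonal to indicators of short tuples. -/
theorem sum_parity_mul_tupleInd {k t : ℕ} (ht : t < k) (S₀ : TotIso k k)
    (T : Fin t → BinSpace k) :
    ∑ S : TotIso k k, (-1 : ℂ) ^ finrank (ZMod 2) (S.1 ⊓ S₀.1 :
      Submodule (ZMod 2) (BinSpace k)) * tupleInd T S = 0 := by
  have hU : finrank (ZMod 2) (span (ZMod 2) (Set.range T)) < k :=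
    (finrank_range_le_card T).trans_lt (by rwa [Fintype.card_fin])
  -- The reflection in such a v fixes the tuple and flips the parity, so the sum equals its own
  -- negative.
  obtain ⟨v, hv, hv1⟩ := exists_nonsingular_mem_perp hU
  have hfix : ∀ i, binReflection v hv1 (T i) = T i := fun i => by
    rw [binReflection_apply, hv (T i) (subset_span ⟨i, rfl⟩), zero_smul, add_zero]
  rw [← self_eq_neg, ← Finset.sum_neg_distrib]
  refine Fintype.sum_equiv (isoPerm k (binReflection v hv1)) _ _ fun S => ?_
  change _ = -(_ ^ finrank (ZMod 2) ((isoMove (binReflection v hv1) S).1 ⊓ S₀.1 :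
      Submodule (ZMod 2) (BinSpace k)) * tupleInd T (isoMove (binReflection v hv1) S))
  rw [neg_one_pow_finrank_reflection_inf, neg_mul, neg_neg]
  congr 1
  classical
  refine if_congr ?_ rfl rfl
  refine forall_congr' fun i => ?_
  rw [← mem_isoMove (binReflection v hv1), hfix]

theorem tupleSpan_ne_top {k t : ℕ} (ht : t < k) : tupleSpan k t ≠ ⊤ := by
  classical
  intro h
  obtain ⟨S₀⟩ := nonempty_totIso k
  have key : ∀ f ∈ tupleSpan k t, ∑ S : TotIso k k, (-1 : ℂ) ^ finrank (ZMod 2) (S.1 ⊓ S₀.1 :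
      Submodule (ZMod 2) (BinSpace k)) * f S = 0 := by
    intro f hf
    induction hf using span_induction with
    | mem f hf =>
      obtain ⟨T, rfl⟩ := hf
      exact sum_parity_mul_tupleInd ht S₀ T
    | zero => simp
    | add f g _ _ hf hg => simp [mul_add, Finset.sum_add_distrib, hf, hg]
    | smul c f _ hf => simp [mul_left_comm _ c, ← Finset.mul_sum, hf]
  -- Against the point mass at S₀ the pairing is a sign, hence nonzero.
  have := key (Pi.single S₀ 1) (h ▸ mem_top)
  simp [Pi.single_apply] at this

theorem tupleSpan_lt_succ {k t : ℕ} (ht : t < k) : tupleSpan k t < tupleSpan k (t + 1) := by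
  refine lt_of_le_not_ge (tupleSpan_le_succ k t) fun h => ?_
  have hall : ∀ j, tupleSpan k (t + j) ≤ tupleSpan k t := by
    have hstep : ∀ j, tupleSpan k (t + j + 1) ≤ tupleSpan k (t + j) := by
      intro j
      induction j with
      | zero => exact h
      | succ j ih => exact tupleSpan_step ih
    intro j
    induction j with
    | zero => exact le_rfl
    | succ j ih => exact (hstep j).trans ih
  have := hall (k - t)
  rw [Nat.add_sub_cancel' ht.le, tupleSpan_self_eq_top, top_le_iff] at this
  exact tupleSpan_ne_top ht this

/-! ### Orthogonality and stable subspaces -/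

/-- The orthogonal complement in the space of complex functions on a finite set. -/
noncomputable def funOrth {ι : Type*} [Fintype ι] (V : Submodule ℂ (ι → ℂ)) :
    Submodule ℂ (ι → ℂ) where
  carrier := {f | ∀ g ∈ V, ∑ i, star (g i) * f i = 0}
  add_mem' hf hg h hh := by
    simp only [Pi.add_apply, mul_add, Finset.sum_add_distrib, hf h hh, hg h hh, add_zero]
  zero_mem' := by simp
  smul_mem' c f hf h hh := by
    simp only [Pi.smul_apply, smul_eq_mul, mul_left_comm _ c, ← Finset.mul_sum, hf h hh, mul_zero]

open scoped ComplexOrder in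
theorem eq_zero_of_mem_funOrth {ι : Type*} [Fintype ι] {V : Submodule ℂ (ι → ℂ)} {f : ι → ℂ}
    (hf : f ∈ V) (hf' : f ∈ funOrth V) : f = 0 := by
  have h : star f ⬝ᵥ f = 0 := hf' f hf
  exact dotProduct_star_self_eq_zero.1 h

theorem exists_add_funOrth {ι : Type*} [Fintype ι] (V : Submodule ℂ (ι → ℂ)) (f : ι → ℂ) :
    ∃ a ∈ V, ∃ b ∈ funOrth V, a + b = f := by
  let e := WithLp.linearEquiv 2 ℂ (ι → ℂ)
  let U : Submodule ℂ (EuclideanSpace ℂ ι) := V.comap e.toLinearMap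
  obtain ⟨a, ha, b, hb, hab⟩ := mem_sup.1
    (U.sup_orthogonal_of_hasOrthogonalProjection ▸ mem_top : e.symm f ∈ U ⊔ Uᗮ)
  refine ⟨e a, ha, e b, fun g hg => ?_, ?_⟩
  · have := (mem_orthogonal U b).1 hb (e.symm g) (by simpa [U] using hg)
    rw [PiLp.inner_apply] at this
    rw [← this]
    refine Finset.sum_congr rfl fun i _ => ?_
    rw [RCLike.inner_apply, mul_comm]
    rfl
  · rw [← map_add, hab, LinearEquiv.apply_symm_apply]

theorem isStableSubspace_inf {k w : ℕ} {V W : Submodule ℂ (TotIso k w → ℂ)}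
    (hV : IsStableSubspace V) (hW : IsStableSubspace W) : IsStableSubspace (V ⊓ W) :=
  fun g f hf => ⟨hV g f hf.1, hW g f hf.2⟩

theorem isStableSubspace_funOrth {k w : ℕ} {V : Submodule ℂ (TotIso k w → ℂ)}
    (hV : IsStableSubspace V) : IsStableSubspace (funOrth V) := by
  intro g f hf h hh
  rw [← hf _ (hV g.symm h hh)]
  refine Fintype.sum_equiv (isoPerm w g) _ _ fun S => ?_
  change _ = star (h (isoMove g.symm (isoMove g S))) * f (isoMove g S)
  rw [isoMove_symm_isoMove]

theorem tupleInd_isoMove {k w t : ℕ} (g : (binForm k).IsometryEquiv (binForm k))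
    (T : Fin t → BinSpace k) (S : TotIso k w) :
    tupleInd T (isoMove g S) = tupleInd (fun i => g.symm (T i)) S := by
  classical
  refine if_congr ?_ rfl rfl
  refine forall_congr' fun i => ?_
  have h := mem_isoMove g S (g.symm (T i))
  rwa [QuadraticMap.IsometryEquiv.apply_symm_apply] at h

theorem isStableSubspace_tupleSpan (k t : ℕ) : IsStableSubspace (tupleSpan k t) := by
  intro g f hf
  induction hf using span_induction with
  | mem f hf =>
    obtain ⟨T, rfl⟩ := hf
    simp only [tupleInd_isoMove]
    exact tupleInd_mem_tupleSpan _
  | zero => exact zero_mem _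
  | add f g _ _ hf hg => exact add_mem hf hg
  | smul c f _ hf => exact smul_mem _ c hf

/-! ### Zonal functions -/

/-- The zonal function at `S₀` given by a polynomial in the size of the intersection. -/
noncomputable def zonal {k : ℕ} (S₀ : TotIso k k) : Polynomial ℂ →ₗ[ℂ] (TotIso k k → ℂ) :=
  LinearMap.pi fun S => Polynomial.leval (interCard S S₀ : ℂ)

theorem zonal_apply {k : ℕ} (S₀ S : TotIso k k) (P : Polynomial ℂ) :
    zonal S₀ P S = P.eval (interCard S S₀ : ℂ) := rfl

theorem zonal_mem_of_isStableSubspace {k : ℕ} {V : Submodule ℂ (TotIso k k → ℂ)}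
    (hV : IsStableSubspace V) {S₀ : TotIso k k} {P : Polynomial ℂ} (h : zonal S₀ P ∈ V)
    (S' : TotIso k k) : zonal S' P ∈ V := by
  obtain ⟨g, rfl⟩ := exists_isoMove_eq S' S₀
  have := hV g _ h
  simp only [zonal_apply, interCard_isoMove] at this
  exact this

theorem zonal_mem_tupleSpan {k t : ℕ} (S₀ : TotIso k k) {P : Polynomial ℂ}
    (hP : P.natDegree ≤ t) : zonal S₀ P ∈ tupleSpan k t := by
  have h : zonal S₀ P = ∑ i ∈ Finset.range (P.natDegree + 1), P.coeff i •
      ∑ T : Fin i → BinSpace k, tupleInd T S₀ • (tupleInd T : TotIso k k → ℂ) := by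
    funext S
    rw [zonal_apply, Polynomial.eval_eq_sum_range, Finset.sum_apply]
    refine Finset.sum_congr rfl fun i _ => ?_
    rw [Pi.smul_apply, Finset.sum_apply, ← sum_tupleInd_mul_tupleInd, smul_eq_mul]
    congr 1
    exact Finset.sum_congr rfl fun T _ => mul_comm _ _
  rw [h]
  refine sum_mem fun i hi => smul_mem _ _ (sum_mem fun T _ => smul_mem _ _ ?_)
  have hi : i ≤ t := (Nat.lt_succ_iff.1 (Finset.mem_range.1 hi)).trans hP
  exact tupleSpan_mono k hi (tupleInd_mem_tupleSpan T)

instance instFiniteIsometryEquiv (k : ℕ) :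
    Finite ((binForm k).IsometryEquiv (binForm k)) :=
  Finite.of_injective (fun g => (g : BinSpace k → BinSpace k)) DFunLike.coe_injective

/-- A function invariant under the stabilizer of `S₀` is zonal. -/
theorem exists_zonal_eq {k : ℕ} (S₀ : TotIso k k) {f : TotIso k k → ℂ}
    (hf : ∀ g : (binForm k).IsometryEquiv (binForm k), isoMove g S₀ = S₀ →
      ∀ S, f (isoMove g S) = f S) :
    ∃ P ∈ Polynomial.degreeLT ℂ (k + 1), zonal S₀ P = f := by
  classical
  let d : TotIso k k → ℕ := fun S =>
    finrank (ZMod 2) (S.1 ⊓ S₀.1 : Submodule (ZMod 2) (BinSpace k))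
  have hd : ∀ S, d S < k + 1 := fun S =>
    Nat.lt_succ_of_le ((Submodule.finrank_mono inf_le_right).trans S₀.2.1.le)
  -- By transitivity on pairs f depends only on dim(S ∩ S₀). The default 0 is never read at an
  -- actual S.
  let r : ℕ → ℂ := fun j => if h : ∃ S, d S = j then f h.choose else 0
  have hr : ∀ S, r (d S) = f S := by
    intro S
    have hex : ∃ S', d S' = d S := ⟨S, rfl⟩
    have h1 : r (d S) = f hex.choose := dif_pos hex
    obtain ⟨g, hg, hg0⟩ := exists_isoMove_pair_eq (S₁ := S) (S₂ := S₀) (S₁' := hex.choose)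
      (S₂' := S₀) (by
        rw [interCard_eq_two_pow, interCard_eq_two_pow]
        exact congrArg (2 ^ ·) hex.choose_spec.symm)
    rw [h1, ← hg, hf g hg0]
  have hinj : Set.InjOn (fun j : ℕ => (2 : ℂ) ^ j) (Finset.range (k + 1)) := by
    intro a _ b _ hab
    have : (2 : ℕ) ^ a = 2 ^ b := by
      have hab : (2 : ℂ) ^ a = 2 ^ b := hab
      exact_mod_cast hab
    exact Nat.pow_right_injective le_rfl this
  refine ⟨Lagrange.interpolate (Finset.range (k + 1)) (fun j => (2 : ℂ) ^ j) r, ?_, ?_⟩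
  · rw [Polynomial.mem_degreeLT]
    simpa using Lagrange.degree_interpolate_lt r hinj
  · funext S
    have h2 : (interCard S S₀ : ℂ) = 2 ^ d S := by
      rw [interCard_eq_two_pow]
      push_cast
      rfl
    rw [zonal_apply, h2, ← hr S]
    exact Lagrange.eval_interpolate_at_node r hinj (Finset.mem_range.2 (hd S))

/-- A nonzero stable subspace contains a nonzero zonal function. -/
theorem exists_zonal_mem {k : ℕ} {V : Submodule ℂ (TotIso k k → ℂ)} (hV : IsStableSubspace V)
    (hV0 : V ≠ ⊥) (S₀ : TotIso k k) :
    ∃ P ∈ Polynomial.degreeLT ℂ (k + 1), zonal S₀ P ∈ V ∧ zonal S₀ P ≠ 0 := by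
  obtain ⟨f, hf, hf0⟩ := exists_mem_ne_zero_of_ne_bot hV0
  obtain ⟨S₁, hS₁⟩ := Function.ne_iff.1 hf0
  obtain ⟨g₀, rfl⟩ := exists_isoMove_eq S₀ S₁
  let H := {g : (binForm k).IsometryEquiv (binForm k) // isoMove g S₀ = S₀}
  have : Fintype H := Fintype.ofFinite H
  -- Summing over the stabilizer of S₀ gives an invariant function. Translating by `g₀` first puts a
  -- nonzero value of f at S₀, which the sum multiplies by the order of the stabilizer.
  let F : TotIso k k → ℂ := ∑ g : H, fun S => f (isoMove g₀ (isoMove g.1 S))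
  have hF : ∀ S, F S = ∑ g : H, f (isoMove g₀ (isoMove g.1 S)) := fun S => Finset.sum_apply _ _ _
  have hFV : F ∈ V := sum_mem fun g _ => hV g.1 _ (hV g₀ f hf)
  have hF0 : F S₀ ≠ 0 := by
    have h1 : F S₀ = Fintype.card H * f (isoMove g₀ S₀) := by
      rw [hF, Finset.sum_congr rfl fun g _ => by rw [g.2], Finset.sum_const, nsmul_eq_mul]
      rfl
    have h2 : Nonempty H := ⟨⟨QuadraticMap.IsometryEquiv.refl _,
      isoMove_eq_of_mem _ fun x hx => hx⟩⟩
    rw [h1]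
    exact mul_ne_zero (Nat.cast_ne_zero.2 Fintype.card_ne_zero) hS₁
  obtain ⟨P, hP, hPF⟩ := exists_zonal_eq S₀ (f := F) (by
    intro h hh S
    rw [hF, hF]
    let φ : H → H := fun g => ⟨h.trans g.1, by rw [isoMove_trans, hh, g.2]⟩
    have hφ : Function.Injective φ := by
      intro a b hab
      refine Subtype.ext (DFunLike.ext _ _ fun x => ?_)
      have h3 := DFunLike.congr_fun (congrArg Subtype.val hab) (h.symm x)
      change a.1 (h (h.symm x)) = b.1 (h (h.symm x)) at h3
      rwa [QuadraticMap.IsometryEquiv.apply_symm_apply] at h3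
    rw [← (Finite.injective_iff_bijective.1 hφ).sum_comp
      (fun g : H => f (isoMove g₀ (isoMove g.1 S)))]
    exact Finset.sum_congr rfl fun g _ => by rw [isoMove_trans h g.1])
  exact ⟨P, hP, hPF ▸ hFV, fun h0 => hF0 (by rw [← hPF, h0]; rfl)⟩

theorem inf_funOrth_ne_bot {ι : Type*} [Fintype ι] {V W : Submodule ℂ (ι → ℂ)} (h : V < W) :
    W ⊓ funOrth V ≠ ⊥ := by
  intro hbot
  refine h.not_ge fun f hf => ?_
  obtain ⟨a, ha, b, hb, rfl⟩ := exists_add_funOrth V f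
  have hbW : b ∈ W := by
    have := W.sub_mem hf (h.le ha)
    rwa [add_sub_cancel_left] at this
  have : b ∈ W ⊓ funOrth V := ⟨hbW, hb⟩
  rw [hbot, mem_bot] at this
  rwa [this, add_zero]

/-! ### Degree against level, by counting dimensions -/

/-- The polynomials of degree at most `k` whose zonal function at `S₀` lies in `tupleSpan k t`. -/
noncomputable def zonalPoly {k : ℕ} (S₀ : TotIso k k) (t : ℕ) : Submodule ℂ (Polynomial ℂ) :=
  (tupleSpan k t).comap (zonal S₀) ⊓ Polynomial.degreeLT ℂ (k + 1)

theorem finiteDimensional_degreeLT (n : ℕ) : FiniteDimensional ℂ (Polynomial.degreeLT ℂ n) :=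
  (Polynomial.degreeLTEquiv ℂ n).symm.finiteDimensional

theorem finrank_degreeLT (n : ℕ) : finrank ℂ (Polynomial.degreeLT ℂ n) = n := by
  rw [(Polynomial.degreeLTEquiv ℂ n).finrank_eq, finrank_fin_fun]

theorem finiteDimensional_zonalPoly {k : ℕ} (S₀ : TotIso k k) (t : ℕ) :
    FiniteDimensional ℂ (zonalPoly S₀ t) :=
  have := finiteDimensional_degreeLT (k + 1)
  Submodule.finiteDimensional_inf_right _ _

/-- The orthogonal difference of consecutive levels is stable and nonzero, so it has a nonzero zonal
function, which the lower level cannot contain. -/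
theorem zonalPoly_lt_succ {k t : ℕ} (S₀ : TotIso k k) (ht : t < k) :
    zonalPoly S₀ t < zonalPoly S₀ (t + 1) := by
  obtain ⟨P, hP, ⟨hP1, hP2⟩, hP0⟩ := exists_zonal_mem
    (isStableSubspace_inf (isStableSubspace_tupleSpan k (t + 1))
      (isStableSubspace_funOrth (isStableSubspace_tupleSpan k t)))
    (inf_funOrth_ne_bot (tupleSpan_lt_succ ht)) S₀
  refine lt_of_le_of_ne (inf_le_inf_right _ (comap_mono (tupleSpan_le_succ k t))) fun h => ?_
  have : P ∈ zonalPoly S₀ t := h ▸ ⟨hP1, hP⟩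
  exact hP0 (eq_zero_of_mem_funOrth this.1 hP2)

/-- Counting down from k + 1 at level k, each strict step loses at least one dimension. -/
theorem finrank_zonalPoly_le {k t : ℕ} (S₀ : TotIso k k) (ht : t ≤ k) :
    finrank ℂ (zonalPoly S₀ t) ≤ t + 1 := by
  induction ht using Nat.decreasingInduction with
  | self =>
    have := finiteDimensional_degreeLT (k + 1)
    exact (Submodule.finrank_mono inf_le_right).trans (finrank_degreeLT (k + 1)).le
  | of_succ t ht ih =>
    have := finiteDimensional_zonalPoly S₀ (t + 1)
    have := Submodule.finrank_lt_finrank_of_lt (zonalPoly_lt_succ S₀ ht)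
    omega

theorem zonalPoly_eq {k t : ℕ} (S₀ : TotIso k k) (ht : t ≤ k) :
    zonalPoly S₀ t = Polynomial.degreeLT ℂ (t + 1) := by
  have := finiteDimensional_zonalPoly S₀ t
  have hle : Polynomial.degreeLT ℂ (t + 1) ≤ zonalPoly S₀ t := by
    refine fun P hP => ⟨?_, Polynomial.degreeLT_mono (by omega) hP⟩
    rw [Polynomial.mem_degreeLT, Polynomial.degree_lt_iff_coeff_zero] at hP
    exact zonal_mem_tupleSpan S₀ (Polynomial.natDegree_le_iff_coeff_eq_zero.2 fun m hm => hP m hm)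
  refine (Submodule.eq_of_le_of_finrank_le hle ?_).symm
  rw [finrank_degreeLT]
  exact finrank_zonalPoly_le S₀ ht

theorem natDegree_le_of_zonal_mem {k t : ℕ} {S₀ : TotIso k k} {P : Polynomial ℂ} (ht : t ≤ k)
    (hP : P ∈ Polynomial.degreeLT ℂ (k + 1)) (h : zonal S₀ P ∈ tupleSpan k t) :
    P.natDegree ≤ t := by
  have : P ∈ zonalPoly S₀ t := ⟨h, hP⟩
  rw [zonalPoly_eq S₀ ht, Polynomial.mem_degreeLT, Polynomial.degree_lt_iff_coeff_zero] at this
  exact Polynomial.natDegree_le_iff_coeff_eq_zero.2 fun m hm => this m hm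

theorem mem_degreeLT_of_natDegree_le {n : ℕ} {P : Polynomial ℂ} (h : P.natDegree ≤ n) :
    P ∈ Polynomial.degreeLT ℂ (n + 1) :=
  Polynomial.mem_degreeLT.2 (Polynomial.degree_lt_iff_coeff_zero _ _ |>.2 fun _ hm =>
    Polynomial.natDegree_le_iff_coeff_eq_zero.1 h _ hm)

/-! ### The irreducible constituents -/

/-- The part of `tupleSpan k (t + 1)` orthogonal to `tupleSpan k t`. -/
noncomputable def harmonicSpace (k t : ℕ) : Submodule ℂ (TotIso k k → ℂ) :=
  tupleSpan k (t + 1) ⊓ funOrth (tupleSpan k t)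

theorem isStableSubspace_harmonicSpace (k t : ℕ) : IsStableSubspace (harmonicSpace k t) :=
  isStableSubspace_inf (isStableSubspace_tupleSpan k (t + 1))
    (isStableSubspace_funOrth (isStableSubspace_tupleSpan k t))

theorem natDegree_of_zonal_mem_harmonicSpace {k t : ℕ} (ht : t < k) {S₀ : TotIso k k}
    {P : Polynomial ℂ} (hP : P ∈ Polynomial.degreeLT ℂ (k + 1))
    (h : zonal S₀ P ∈ harmonicSpace k t) (h0 : zonal S₀ P ≠ 0) : P.natDegree = t + 1 := by
  refine le_antisymm (natDegree_le_of_zonal_mem ht hP h.1) (Nat.lt_of_not_le fun hle => ?_)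
  exact h0 (eq_zero_of_mem_funOrth (zonal_mem_tupleSpan S₀ hle) h.2)

theorem hasZonalDegree_harmonicSpace {k t : ℕ} (ht : t < k) :
    HasZonalDegree (harmonicSpace k t) (t + 1) := by
  obtain ⟨S₀⟩ := nonempty_totIso k
  obtain ⟨P, hP, hPV, hP0⟩ := exists_zonal_mem (isStableSubspace_harmonicSpace k t)
    (inf_funOrth_ne_bot (tupleSpan_lt_succ ht)) S₀
  refine ⟨ht, P, ?_, natDegree_of_zonal_mem_harmonicSpace ht hP hPV hP0,
    zonal_mem_of_isStableSubspace (isStableSubspace_harmonicSpace k t) hPV⟩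
  rintro rfl
  exact hP0 (map_zero _)

/-- A proper nonzero stable W and its orthogonal complement would both have zonal functions at S₀ of
degree t + 1. Cancelling top coefficients gives an element of `tupleSpan k t`, hence zero, so the
two functions are proportional, yet orthogonal. -/
theorem isIrreducibleSubspace_harmonicSpace {k t : ℕ} (ht : t < k) :
    IsIrreducibleSubspace (harmonicSpace k t) := by
  refine ⟨isStableSubspace_harmonicSpace k t, inf_funOrth_ne_bot (tupleSpan_lt_succ ht),
    fun W hW hle => ?_⟩
  by_contra! hne
  obtain ⟨S₀⟩ := nonempty_totIso k
  obtain ⟨P, hP, hPW, hP0⟩ := exists_zonal_mem hW hne.1 S₀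
  obtain ⟨Q, hQ, ⟨hQV, hQW⟩, hQ0⟩ := exists_zonal_mem
    (isStableSubspace_inf (isStableSubspace_harmonicSpace k t) (isStableSubspace_funOrth hW))
    (inf_funOrth_ne_bot (lt_of_le_of_ne hle hne.2)) S₀
  have hPd := natDegree_of_zonal_mem_harmonicSpace ht hP (hle hPW) hP0
  have hQd := natDegree_of_zonal_mem_harmonicSpace ht hQ hQV hQ0
  have hdeg : (Q.coeff (t + 1) • P - P.coeff (t + 1) • Q).natDegree ≤ t := by
    refine Polynomial.natDegree_le_iff_coeff_eq_zero.2 fun m hm => ?_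
    rw [Polynomial.coeff_sub, Polynomial.coeff_smul, Polynomial.coeff_smul, smul_eq_mul,
      smul_eq_mul]
    rcases (Nat.succ_le_of_lt hm).eq_or_lt with rfl | (hm : t + 1 < m)
    · ring
    · rw [Polynomial.coeff_eq_zero_of_natDegree_lt (p := P) (hPd.trans_lt hm),
        Polynomial.coeff_eq_zero_of_natDegree_lt (p := Q) (hQd.trans_lt hm)]
      ring
  have hz := eq_zero_of_mem_funOrth (zonal_mem_tupleSpan S₀ hdeg) (by
    rw [map_sub, map_smul, map_smul]
    exact sub_mem (smul_mem _ _ (hle hPW).2) (smul_mem _ _ hQV.2))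
  rw [map_sub, map_smul, map_smul, sub_eq_zero] at hz
  have hc : Q.coeff (t + 1) ≠ 0 := by
    have : Q ≠ 0 := by
      rintro rfl
      exact hQ0 (map_zero _)
    rw [← hQd]
    exact Polynomial.leadingCoeff_ne_zero.2 this
  have h1 : Q.coeff (t + 1) • zonal S₀ P ∈ funOrth W := hz ▸ smul_mem _ _ hQW
  have h2 := eq_zero_of_mem_funOrth (smul_mem _ _ hPW) h1
  exact (smul_ne_zero hc hP0) h2

/-! ### Designs and the case of equality -/

theorem AverageEq.of_mem_tupleSpan {k t : ℕ} {A : Finset (TotIso k k)}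
    (h : ∀ T : Fin t → BinSpace k, AverageEq A (tupleInd T)) {f : TotIso k k → ℂ}
    (hf : f ∈ tupleSpan k t) : AverageEq A f := by
  induction hf using span_induction with
  | mem f hf => obtain ⟨T, rfl⟩ := hf; exact h T
  | zero => simp [AverageEq]
  | add f g _ _ hf hg =>
    simp only [AverageEq, Pi.add_apply, Finset.sum_add_distrib, add_div] at hf hg ⊢
    rw [hf, hg]
  | smul c f _ hf =>
    simp only [AverageEq, Pi.smul_apply, smul_eq_mul, ← Finset.mul_sum, mul_div_assoc] at hf ⊢
    rw [hf]

theorem tupleInd_zero {k w : ℕ} (T : Fin 0 → BinSpace k) :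
    (tupleInd T : TotIso k w → ℂ) = 1 := by
  funext S
  simp [tupleInd]

theorem one_mem_tupleSpan (k t : ℕ) : (1 : TotIso k k → ℂ) ∈ tupleSpan k t := by
  rw [← tupleInd_zero Fin.elim0]
  exact tupleSpan_mono k (Nat.zero_le t) (tupleInd_mem_tupleSpan _)

/-- Split f at level t + 1 into a part at level t and a part in `harmonicSpace k t`. The latter sums
to zero over A by the design condition and over X_k by orthogonality to constants. -/
theorem averageEq_of_isIsotropicDesign {k t : ℕ} (ht : t ≤ k) {A : Finset (TotIso k k)}
    (hA : A.Nonempty) (h : IsIsotropicDesign t A) {f : TotIso k k → ℂ}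
    (hf : f ∈ tupleSpan k t) : AverageEq A f := by
  induction t generalizing f with
  | zero =>
    refine AverageEq.of_mem_tupleSpan (fun T => ?_) hf
    obtain ⟨S, hS⟩ := hA
    rw [tupleInd_zero, AverageEq]
    simp only [Pi.one_apply, Finset.sum_const, nsmul_eq_mul, mul_one]
    rw [div_self (Nat.cast_ne_zero.2 (Finset.card_ne_zero_of_mem hS)),
      div_self (Nat.cast_ne_zero.2 (Finset.card_ne_zero_of_mem (Finset.mem_univ S)))]
  | succ t ih =>
    obtain ⟨a, ha, b, hb, rfl⟩ := exists_add_funOrth (tupleSpan k t) f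
    have hb' : b ∈ harmonicSpace k t := by
      refine ⟨?_, hb⟩
      have := sub_mem hf (tupleSpan_le_succ k t ha)
      rwa [add_sub_cancel_left] at this
    have h1 : ∑ S ∈ A, b S = 0 := h (t + 1) (by omega) le_rfl _
      (isIrreducibleSubspace_harmonicSpace ht) (hasZonalDegree_harmonicSpace ht) b hb'
    have h2 : ∑ S, b S = 0 := by simpa using hb 1 (one_mem_tupleSpan k t)
    have h3 := ih (by omega) (fun m hm hmt => h m hm (by omega)) ha
    simp only [AverageEq, Pi.add_apply, Finset.sum_add_distrib, h1, h2, add_zero] at h3 ⊢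
    exact h3

theorem eq_of_forall_isoMove {k w : ℕ} {f : TotIso k w → ℂ}
    (h : ∀ g S, f (isoMove g S) = f S) (S S' : TotIso k w) : f S = f S' := by
  obtain ⟨g, rfl⟩ := exists_isoMove_eq S S'
  exact (h g S).symm

theorem mem_tupleSpan_zero {k : ℕ} {f : TotIso k k → ℂ} (h : ∀ S S', f S = f S') :
    f ∈ tupleSpan k 0 := by
  obtain ⟨S₀⟩ := nonempty_totIso k
  have : f = f S₀ • (1 : TotIso k k → ℂ) := by
    funext S
    simp [h S S₀]
  rw [this]
  exact smul_mem _ _ (one_mem_tupleSpan k 0)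

/-- An irreducible subspace whose zonal functions have positive degree consists of functions with
sum zero. -/
theorem sum_eq_zero_of_hasZonalDegree {k m : ℕ} (hm : 1 ≤ m)
    {V : Submodule ℂ (TotIso k k → ℂ)} (hV : IsIrreducibleSubspace V) (hVm : HasZonalDegree V m)
    {f : TotIso k k → ℂ} (hf : f ∈ V) : ∑ S, f S = 0 := by
  obtain ⟨hmk, P, hP0, hPm, hPV⟩ := hVm
  have hsum : ∀ (g : (binForm k).IsometryEquiv (binForm k)) (f : TotIso k k → ℂ),
      ∑ S, f (isoMove g S) = ∑ S, f S := fun g f =>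
    (isoPerm k g).sum_comp f
  let L : (TotIso k k → ℂ) →ₗ[ℂ] ℂ := ∑ S, LinearMap.proj S
  have hL : ∀ f, L f = ∑ S, f S := fun f => by simp [L]
  have hstab : IsStableSubspace (LinearMap.ker L) := by
    intro g f hf
    rw [LinearMap.mem_ker, hL] at hf ⊢
    rw [hsum, hf]
  rcases hV.2.2 _ (isStableSubspace_inf hV.1 hstab) inf_le_left with h | h
  · exfalso
    obtain ⟨S₀⟩ := nonempty_totIso k
    have hz : zonal S₀ P ∈ V := hPV S₀
    -- A translate has the same sum, so the difference lies in the zero intersection. The zonal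
    -- function is then constant, against degree m ≥ 1.
    have hconst : ∀ g S, zonal S₀ P (isoMove g S) = zonal S₀ P S := by
      intro g S
      have hmem : (fun S => zonal S₀ P (isoMove g S)) - zonal S₀ P ∈ V ⊓ LinearMap.ker L := by
        refine ⟨sub_mem (hV.1 g _ hz) hz, ?_⟩
        change L _ = 0
        rw [map_sub, hL, hL, hsum, sub_self]
      rw [h, mem_bot] at hmem
      exact sub_eq_zero.1 (congrFun hmem S)
    have := natDegree_le_of_zonal_mem (Nat.zero_le k)
      (mem_degreeLT_of_natDegree_le (hPm.trans_le hmk))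
      (mem_tupleSpan_zero (eq_of_forall_isoMove hconst))
    omega
  · have : f ∈ V ⊓ LinearMap.ker L := h.symm ▸ hf
    rw [← hL]
    exact this.2

/-- The zonal function lies in V and in the stable space `tupleSpan k m`; it is nonzero because a
nonzero polynomial of degree at most k has a nonzero zonal function. Irreducibility does the rest.
-/
theorem le_tupleSpan_of_hasZonalDegree {k m : ℕ} {V : Submodule ℂ (TotIso k k → ℂ)}
    (hV : IsIrreducibleSubspace V) (hVm : HasZonalDegree V m) : V ≤ tupleSpan k m := by
  obtain ⟨hmk, P, hP0, hPm, hPV⟩ := hVm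
  obtain ⟨S₀⟩ := nonempty_totIso k
  rcases hV.2.2 _ (isStableSubspace_inf hV.1 (isStableSubspace_tupleSpan k m)) inf_le_left
    with h | h
  · exfalso
    have h0 : zonal S₀ P = 0 := by
      have : zonal S₀ P ∈ V ⊓ tupleSpan k m := ⟨hPV S₀, zonal_mem_tupleSpan S₀ hPm.le⟩
      rwa [h, mem_bot] at this
    have h1 := natDegree_le_of_zonal_mem (Nat.zero_le k)
      (mem_degreeLT_of_natDegree_le (hPm.trans_le hmk)) (h0 ▸ zero_mem _)
    rw [Polynomial.eq_C_of_natDegree_le_zero h1] at h0 hP0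
    have h2 := congrFun h0 S₀
    rw [zonal_apply, Polynomial.eval_C] at h2
    exact hP0 (by rw [h2]; exact map_zero _)
  · exact inf_eq_left.1 h

theorem interMoment_eq_univ_iff_isIsotropicDesign {k : ℕ} (t : ℕ) {A : Finset (TotIso k k)}
    (hA : A.Nonempty) :
    interMoment t A = interMoment t (Finset.univ : Finset (TotIso k k)) ↔
      IsIsotropicDesign t A := by
  rw [interMoment_eq_univ_iff t hA]
  constructor
  · intro h m hm hmt V hV hVm f hf
    have h1 := AverageEq.of_mem_tupleSpan h
      (tupleSpan_mono k hmt (le_tupleSpan_of_hasZonalDegree hV hVm hf))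
    rw [AverageEq, sum_eq_zero_of_hasZonalDegree hm hV hVm hf, zero_div, div_eq_zero_iff] at h1
    exact h1.resolve_right (Nat.cast_ne_zero.2 (Finset.card_ne_zero.2 hA))
  · intro h T
    rcases le_total t k with htk | hkt
    · exact averageEq_of_isIsotropicDesign htk hA h (tupleInd_mem_tupleSpan T)
    -- For t ≥ k the conditions up to k suffice, as level k is already the whole space.
    · exact averageEq_of_isIsotropicDesign le_rfl hA (fun m hm hmk => h m hm (hmk.trans hkt))
        (tupleSpan_self_eq_top k ▸ mem_top)

theorem mainTheorem6 :
    ∃ d : ℕ → ℕ → ℕ → ℝ,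
      (∀ w k t : ℕ, w ≤ k →
        d w k t = interMoment t (Finset.univ : Finset (TotIso k w))) ∧
      (∀ w k t : ℕ, w ≤ k → ∀ A : Finset (TotIso k w), A.Nonempty →
        d w k t ≤ interMoment t A) ∧
      (∀ k t : ℕ, ∀ A : Finset (TotIso k k), A.Nonempty →
        (interMoment t A = d k k t ↔ IsIsotropicDesign t A)) :=
  ⟨fun w k t => interMoment t (Finset.univ : Finset (TotIso k w)), fun _ _ _ _ => rfl,
    fun _ _ t _ _ hA => interMoment_univ_le t hA,
    fun _ t _ hA => interMoment_eq_univ_iff_isIsotropicDesign t hA⟩
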